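/- Let $\mathbb{K}$ be a field of arbitrary characteristic. A Poisson bracket on a commutative $\mathbb K$-algebra is a $\mathbb K$-bilinear alternating bracket satisfying the Jacobi identity and the Leibniz rule. Let $A=\mathbb{K}[X_1][X_2;\alpha_2,\delta_2]_P\cdots[X_n;\alpha_n,\delta_n]_P$ be an iterated Poisson–Ore extension: writing $A_i=\mathbb K[X_1,\dots,X_i]$, the polynomial algebra $A=A_n$ carries a Poisson bracket such that each $A_i$ is a Poisson subalgebra and $\{X_i,a\}=\alpha_i(a)X_i+\delta_i(a)$ for $a\in A_{i-1}$, $2\le i\le n$, where $\alpha_i$ is a Poisson derivation of $A_{i-1}$, i.e. a $\mathbb K$-derivation with $\alpha_i(\{a,b\})=\{\alpha_i(a),b\}+\{a,\alpha_i(b)\}$, and $\delta_i$ is a Poisson $\alpha_i$-derivation, i.e. a $\mathbb K$-derivation with $\delta_i(\{a,b\})=\{\delta_i(a),b\}+\{a,\delta_i(b)\}+\alpha_i(a)\delta_i(b)-\delta_i(a)\alpha_i(b)$. Assume that $A$ belongs to the class $\mathcal P$, that is: (a) there is a skew-symmetric matrix $\boldsymbol\lambda=(\lambda_{ij})\in\mathcal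 M_n(\mathbb K)$ (with zero diagonal) such that $\alpha_i(X_j)=\lambda_{ij}X_j$ for $1\le j<i\le n$; (b) for $2\le i\le n$ there are $\eta_i\in\mathbb K\setminus\{0\}$ and $\mathbb K$-linear maps $D_{i,k}:A_{i-1}\to A_{i-1}$ ($k\ge 0$) with $D_{i,0}=\mathrm{id}$, $D_{i,1}=\delta_i$, $D_{i,m}(ab)=\sum_{k=0}^m D_{i,k}(a)D_{i,m-k}(b)$, $D_{i,k}D_{i,l}=\binom{k+l}{k}D_{i,k+l}$, for each $a$ one has $D_{i,k}(a)=0$ for all large $k$, $D_{i,k}\alpha_i=\alpha_iD_{i,k}+k\eta_iD_{i,k}$, and $$D_{i,m}(\{a,b\})=\sum_{k=0}^m\Big(\{D_{i,k}(a),D_{i,m-k}(b)\}+k\big(\alpha_iD_{i,m-k}(a)\,D_{i,k}(b)-D_{i,k}(a)\,\alpha_iD_{i,m-k}(b)\big)\Big);$$ (c) $\alpha_iD_{j,k}=D_{j,k}\alpha_i+k\lambda_{ij}D_{j,k}$ on $A_{j-1}$ for all $2\le j<i\le n$ and $k\ge0$. Equip $\mathrm{Frac}\,A$ with the unique Poisson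 bracket extending that of $A$. Define elements $X_{i,j}\in\mathrm{Frac}\,A$ for $j=n+1,n,\dots,2$ by $X_{i,n+1}=X_i$ and, for $2\le j\le n$, $X_{i,j}=X_{i,j+1}$ if $i\ge j$ and $$X_{i,j}=\sum_{k\ge0}\eta_j^{-k}\,D_{j,k}(X_{i,j+1})\,X_{j,j+1}^{-k}\qquad (i<j),$$ where $D_{j,k}(X_{i,j+1})$ denotes the value of the polynomial $D_{j,k}(X_i)\in\mathbb K[X_1,\dots,X_{j-1}]$ at $X_l=X_{l,j+1}$. Put $C_j=\mathbb K[X_{1,j},\dots,X_{n,j}]\subseteq\mathrm{Frac}\,A$, $T_i=X_{i,2}$ and $\overline A=C_2$. Then: (1) for $2\le j\le n+1$, the elements $X_{1,j},\dots,X_{n,j}$ are algebraically independent over $\mathbb K$ and $C_j$ is a Poisson subalgebra of $\mathrm{Frac}\,A$; (2) for $2\le j\le n$, $X_{j,j}=X_{j,j+1}\neq0$ and, with $S_j=\{X_{j,j+1}^m: m\ge0\}$, one has $C_jS_j^{-1}=C_{j+1}S_j^{-1}$ inside $\mathrm{Frac}\,A$; (3) $\overline A$ is the Poisson affine space $\mathbb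 K_{\boldsymbol\lambda}[T_1,\dots,T_n]$: it is a polynomial algebra in the algebraically independent elements $T_1,\dots,T_n$ and $\{T_i,T_j\}=\lambda_{ij}T_iT_j$ for all $i,j$; (4) $\mathrm{Frac}\,A=\mathrm{Frac}\,\overline A$ as Poisson algebras: $\mathrm{Frac}\,A$ is a field of fractions of $\overline A$, and its bracket is the unique extension of the bracket of $\overline A$. -/

import Mathlib

open MvPolynomial

noncomputable section

/-- A Poisson bracket on a commutative `K`-algebra `A`: a `K`-bilinear alternating bracket that
satisfies the Jacobi identity and the Leibniz rule. -/
structure PoissonBracket (K A : Type*) [CommRing K] [CommRing A] [Algebra K A] where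
  toLin : A →ₗ[K] A →ₗ[K] A
  self' : ∀ a, toLin a a = 0
  jacobi' : ∀ a b c,
    toLin a (toLin b c) + toLin b (toLin c a) + toLin c (toLin a b) = 0
  leibniz' : ∀ a b c, toLin a (b * c) = b * toLin a c + toLin a b * c

namespace PoissonBracket

section Basic

variable {K A : Type*} [CommRing K] [CommRing A] [Algebra K A]

instance : CoeFun (PoissonBracket K A) (fun _ => A → (A →ₗ[K] A)) := ⟨fun P => ⇑P.toLin⟩

theorem skew (P : PoissonBracket K A) (a b : A) : P a b = - P b a := by
  have h := P.self' (a + b)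
  simp only [map_add, LinearMap.add_apply, P.self'] at h
  linear_combination h

/-- The Hamiltonian derivation `{a, -}`. -/
def ham (P : PoissonBracket K A) (a : A) : Derivation K A A :=
  Derivation.mk' (P.toLin a) (fun b c => by
    rw [P.leibniz' a b c, smul_eq_mul, smul_eq_mul, mul_comm (P.toLin a b) c])

@[simp] theorem ham_apply (P : PoissonBracket K A) (a b : A) : P.ham a b = P a b := rfl

/-- A subalgebra is a Poisson subalgebra if it is closed under the bracket. -/
def IsPoissonSubalgebra (P : PoissonBracket K A) (B : Subalgebra K A) : Prop :=
  ∀ a ∈ B, ∀ b ∈ B, P a b ∈ B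

/-- The bracket of a Poisson subalgebra. -/
def restrict (P : PoissonBracket K A) (B : Subalgebra K A) (hB : P.IsPoissonSubalgebra B) :
    PoissonBracket K B where
  toLin := LinearMap.mk₂ K (fun a b => ⟨P a b, hB a a.2 b b.2⟩)
    (fun a a' b => by ext; simp) (fun r a b => by ext; simp)
    (fun a b b' => by ext; simp) (fun r a b => by ext; simp)
  self' a := by ext; exact P.self' a
  jacobi' a b c := by ext; exact P.jacobi' a b c
  leibniz' a b c := by ext; exact P.leibniz' a b c

@[simp] theorem restrict_apply (P : PoissonBracket K A) (B : Subalgebra K A)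
    (hB : P.IsPoissonSubalgebra B) (a b : B) : (P.restrict B hB a b : A) = P a b := rfl

end Basic

section Fraction

variable {K A F : Type*} [CommRing K] [CommRing A] [IsDomain A] [Algebra K A] [Field F]
  [Algebra K F] [Algebra A F] [IsScalarTower K A F] [IsFractionRing A F]

/-- Two derivations of `F = Frac A` that agree on `A` are equal. -/
theorem der_ext {N : Type*} [AddCommGroup N] [Module K N] [Module F N]
    (A : Type*) [CommRing A] [IsDomain A] [Algebra A F] [IsFractionRing A F]
    {d d' : Derivation K F N} (h : ∀ a : A, d (algebraMap A F a) = d' (algebraMap A F a)) :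
    d = d' := by
  ext f
  obtain ⟨a, s, hs, rfl⟩ := IsFractionRing.div_surjective (A := A) f
  have hs0 : algebraMap A F s ≠ 0 := IsFractionRing.to_map_ne_zero_of_mem_nonZeroDivisors hs
  have key : ∀ e : Derivation K F N, e (algebraMap A F a) =
      (algebraMap A F a / algebraMap A F s) • e (algebraMap A F s)
        + algebraMap A F s • e (algebraMap A F a / algebraMap A F s) := fun e => by
    rw [← e.leibniz, div_mul_cancel₀ _ hs0]
  have h1 := key d
  rw [h a, key d', h s] at h1
  exact (smul_right_injective N hs0 (add_left_cancel h1)).symm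

theorem isUnit_end {A : Type*} [CommRing A] [IsDomain A] (F : Type*) [Field F] [Algebra A F]
    [IsFractionRing A F] {N : Type*} [AddCommGroup N] [Module A N] [Module F N]
    [IsScalarTower A F N] (s : nonZeroDivisors A) :
    IsUnit (algebraMap A (Module.End A N) s) := by
  have hs0 : algebraMap A F s ≠ 0 := IsFractionRing.to_map_ne_zero_of_mem_nonZeroDivisors s.2
  rw [Module.End.isUnit_iff]
  constructor
  · intro x y hxy
    simp only [Module.algebraMap_end_apply] at hxy
    rw [← algebraMap_smul F (s : A) x, ← algebraMap_smul F (s : A) y] at hxy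
    exact smul_right_injective N hs0 hxy
  · intro y
    refine ⟨(algebraMap A F s)⁻¹ • y, ?_⟩
    simp only [Module.algebraMap_end_apply]
    rw [← algebraMap_smul F (s : A), smul_inv_smul₀ hs0]

/-- The extension to `F = Frac A` of a derivation of `A` with values in an `F`-vector space. -/
def extendDer {N : Type*} [AddCommGroup N] [Module K N] [Module A N] [Module F N]
    [IsScalarTower K A N] [IsScalarTower K F N] [IsScalarTower A F N] (d : Derivation K A N) :
    Derivation K F N :=
  ((IsLocalizedModule.lift (nonZeroDivisors A) (KaehlerDifferential.map K K A F)
    d.liftKaehlerDifferential (isUnit_end F)).extendScalarsOfIsLocalization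
      (nonZeroDivisors A) F).compDer (KaehlerDifferential.D K F)

@[simp] theorem extendDer_algebraMap {N : Type*} [AddCommGroup N] [Module K N] [Module A N]
    [Module F N] [IsScalarTower K A N] [IsScalarTower K F N] [IsScalarTower A F N]
    (d : Derivation K A N) (a : A) : extendDer (F := F) d (algebraMap A F a) = d a := by
  have h : extendDer (F := F) d (algebraMap A F a) = IsLocalizedModule.lift (nonZeroDivisors A)
    (KaehlerDifferential.map K K A F) d.liftKaehlerDifferential (isUnit_end F)
    (KaehlerDifferential.D K F (algebraMap A F a)) := rfl
  rw [h, ← KaehlerDifferential.map_D K K A F, IsLocalizedModule.lift_apply]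
  simp

/-- For `a ∈ A`, the derivation `{a, -}` of `F = Frac A`, as a derivation in `a`. -/
def fracAux (P : PoissonBracket K A) (F : Type*) [Field F] [Algebra K F] [Algebra A F]
    [IsScalarTower K A F] [IsFractionRing A F] : Derivation K A (Derivation K F F) :=
  Derivation.mk'
    { toFun := fun a => extendDer (F := F) ((Algebra.linearMap A F).compDer (P.ham a))
      map_add' := fun a b => der_ext A fun c => by simp
      map_smul' := fun r a => der_ext A fun c => by
        simp }
    (fun a b => der_ext A fun c => by
      have h : P (a * b) c = a * P b c + b * P a c := by
        rw [P.skew (a * b) c, P.leibniz' c a b, P.skew b c, P.skew a c]; ring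
      simp [h, Algebra.smul_def])

theorem fracAux_apply (P : PoissonBracket K A) (a b : A) :
    P.fracAux F a (algebraMap A F b) = algebraMap A F (P a b) := by
  simp [fracAux]

/-- The bracket of `Frac A` as a bilinear map. -/
def fracLin (P : PoissonBracket K A) (F : Type*) [Field F] [Algebra K F] [Algebra A F]
    [IsScalarTower K A F] [IsFractionRing A F] : F →ₗ[K] F →ₗ[K] F :=
  LinearMap.mk₂ K (fun f g => extendDer (F := F) (P.fracAux F) f g)
    (by simp) (by simp) (by simp) (by simp)

theorem fracLin_eq (P : PoissonBracket K A) (f g : F) :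
    P.fracLin F f g = extendDer (F := F) (P.fracAux F) f g := rfl

theorem fracLin_algebraMap (P : PoissonBracket K A) (a b : A) :
    P.fracLin F (algebraMap A F a) (algebraMap A F b) = algebraMap A F (P a b) := by
  rw [fracLin_eq, extendDer_algebraMap, fracAux_apply]

theorem fracLin_leibniz (P : PoissonBracket K A) (f g h : F) :
    P.fracLin F f (g * h) = g * P.fracLin F f h + P.fracLin F f g * h := by
  simp only [fracLin_eq, Derivation.leibniz, smul_eq_mul]
  ring

theorem fracLin_leibniz_left (P : PoissonBracket K A) (f g h : F) :
    P.fracLin F (f * g) h = f * P.fracLin F g h + g * P.fracLin F f h := by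
  simp only [fracLin_eq, Derivation.leibniz, smul_eq_mul, Derivation.add_apply,
    Derivation.smul_apply]

/-- The derivation `{-, g}` of `F`. -/
def fracRight (P : PoissonBracket K A) (g : F) : Derivation K F F :=
  Derivation.mk' ((P.fracLin F).flip g) (fun a b => P.fracLin_leibniz_left a b g)

theorem fracLin_skew (P : PoissonBracket K A) (f g : F) :
    P.fracLin F f g = - P.fracLin F g f := by
  have h1 : ∀ (a : A) (g : F), P.fracLin F (algebraMap A F a) g
      = - P.fracLin F g (algebraMap A F a) := fun a g => by
    have : extendDer (F := F) (P.fracAux F) (algebraMap A F a)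
        = - P.fracRight (algebraMap A F a) := der_ext A fun b => by
      rw [← fracLin_eq, fracLin_algebraMap, Derivation.neg_apply]
      change _ = - P.fracLin F (algebraMap A F b) (algebraMap A F a)
      rw [fracLin_algebraMap, P.skew a b, map_neg]
    exact congrArg (fun d : Derivation K F F => d g) this
  have : P.fracRight g = - extendDer (F := F) (P.fracAux F) g := der_ext A fun b => by
    rw [Derivation.neg_apply, ← fracLin_eq, ← h1]
    rfl
  exact congrArg (fun d : Derivation K F F => d f) this

theorem fracLin_self (P : PoissonBracket K A) (f : F) : P.fracLin F f f = 0 := by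
  obtain ⟨a, s, hs, rfl⟩ := IsFractionRing.div_surjective (A := A) f
  have hs0 : algebraMap A F s ≠ 0 := IsFractionRing.to_map_ne_zero_of_mem_nonZeroDivisors hs
  set t := algebraMap A F s with ht
  set f := algebraMap A F a / t with hf
  have e : algebraMap A F a = t * f := by rw [hf, mul_div_cancel₀ _ hs0]
  have h0 : P.fracLin F (t * f) (t * f) = 0 := by
    rw [← e, fracLin_algebraMap, P.self', map_zero]
  have h1 : P.fracLin F t t = 0 := by
    rw [ht, fracLin_algebraMap, P.self', map_zero]
  rw [fracLin_leibniz, fracLin_leibniz_left, fracLin_leibniz_left, h1, P.fracLin_skew f t] at h0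
  have h2 : t * t * P.fracLin F f f = 0 := by linear_combination h0
  exact (mul_eq_zero.mp h2).resolve_left (mul_ne_zero hs0 hs0)

theorem fracLin_jacobi (P : PoissonBracket K A) (f g h : F) :
    P.fracLin F f (P.fracLin F g h) + P.fracLin F g (P.fracLin F h f)
      + P.fracLin F h (P.fracLin F f g) = 0 := by
  have step : ∀ f g : F, (∀ c : A, P.fracLin F f (P.fracLin F g (algebraMap A F c))
      + P.fracLin F g (P.fracLin F (algebraMap A F c) f)
      + P.fracLin F (algebraMap A F c) (P.fracLin F f g) = 0) → ∀ h : F,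
      P.fracLin F f (P.fracLin F g h) + P.fracLin F g (P.fracLin F h f)
      + P.fracLin F h (P.fracLin F f g) = 0 := by
    intro f g hc h
    have e : ∀ h, P.fracLin F f (P.fracLin F g h) + P.fracLin F g (P.fracLin F h f)
        + P.fracLin F h (P.fracLin F f g) = (⁅extendDer (F := F) (P.fracAux F) f,
          extendDer (F := F) (P.fracAux F) g⁆ - extendDer (F := F) (P.fracAux F)
            (P.fracLin F f g)) h := fun h => by
      rw [Derivation.sub_apply, Derivation.commutator_apply, P.fracLin_skew h f,
        P.fracLin_skew h]
      simp only [← fracLin_eq, map_neg]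
      ring
    have : (⁅extendDer (F := F) (P.fracAux F) f, extendDer (F := F) (P.fracAux F) g⁆
        - extendDer (F := F) (P.fracAux F) (P.fracLin F f g)) = 0 := der_ext A fun c => by
      rw [← e, hc, Derivation.zero_apply]
    rw [e, this, Derivation.zero_apply]
  refine step f g (fun c => ?_) h
  have h1 : ∀ (a b : A) (h : F), _ := fun a b => step (algebraMap A F a) (algebraMap A F b)
    (fun c => by
      simp only [fracLin_algebraMap, ← map_add]
      rw [P.jacobi' a b c, map_zero])
  have h2 := step (algebraMap A F c) f (fun b => by
    linear_combination h1 b c f) g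
  linear_combination h2

/-- The Poisson bracket of `F = Frac A`: the unique extension of the bracket of `A`
(see `frac_algebraMap` and `frac_unique`). -/
def frac (P : PoissonBracket K A) (F : Type*) [Field F] [Algebra K F] [Algebra A F]
    [IsScalarTower K A F] [IsFractionRing A F] : PoissonBracket K F where
  toLin := P.fracLin F
  self' := P.fracLin_self
  jacobi' := P.fracLin_jacobi
  leibniz' := P.fracLin_leibniz

@[simp] theorem frac_algebraMap (P : PoissonBracket K A) (a b : A) :
    P.frac F (algebraMap A F a) (algebraMap A F b) = algebraMap A F (P a b) :=
  P.fracLin_algebraMap a b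

theorem frac_unique (P : PoissonBracket K A) (Q : PoissonBracket K F)
    (h : ∀ a b : A, Q (algebraMap A F a) (algebraMap A F b) = algebraMap A F (P a b)) :
    Q = P.frac F := by
  have h1 : ∀ (a : A) (g : F), Q (algebraMap A F a) g = P.frac F (algebraMap A F a) g := by
    intro a g
    have : Q.ham (algebraMap A F a) = (P.frac F).ham (algebraMap A F a) :=
      der_ext A fun b => by simp [h]
    exact congrArg (fun d : Derivation K F F => d g) this
  have h2 : ∀ f g : F, Q f g = P.frac F f g := by
    intro f g
    have : Q.ham g = (P.frac F).ham g := der_ext A fun b => by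
      rw [ham_apply, ham_apply, Q.skew, (P.frac F).skew, h1]
    rw [Q.skew, (P.frac F).skew]
    exact congrArg (fun d : Derivation K F F => - d f) this
  obtain ⟨l, _, _, _⟩ := Q
  have : l = (P.frac F).toLin := by ext f g; exact h2 f g
  subst this
  rfl

end Fraction

section HigherDerivation

variable {K A : Type*} [CommRing K] [CommRing A] [Algebra K A]

/-- `α` is a Poisson derivation. -/
def IsPoissonDerivation (P : PoissonBracket K A) (α : Derivation K A A) : Prop :=
  ∀ a b, α (P a b) = P (α a) b + P a (α b)

/-- `δ` is a Poisson `α`-derivation. -/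
def IsPoissonAlphaDerivation (P : PoissonBracket K A) (α δ : Derivation K A A) : Prop :=
  ∀ a b, δ (P a b) = P (δ a) b + P a (δ b) + α a * δ b - δ a * α b

/-- Higher derivations `(D_i)` of a `K`-algebra. -/
structure IsHigherDerivation (D : ℕ → A →ₗ[K] A) : Prop where
  zero : D 0 = LinearMap.id
  mul : ∀ m a b, D m (a * b) = ∑ i ∈ Finset.range (m + 1), D i a * D (m - i) b

/-- `D_i D_j = binom(i+j, i) D_{i+j}`. -/
def IsIterative (D : ℕ → A →ₗ[K] A) : Prop :=
  ∀ i j a, D i (D j a) = (i + j).choose i • D (i + j) a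

/-- Every `a` is killed by all but finitely many `D_i`. -/
def IsLocallyNilpotent (D : ℕ → A →ₗ[K] A) : Prop :=
  ∀ a, ∃ m, ∀ i, m ≤ i → D i a = 0

/-- Higher `(η, α)`-skew Poisson derivations of a Poisson algebra. -/
structure IsHigherSkewPoisson (P : PoissonBracket K A) (η : K) (α : Derivation K A A)
    (D : ℕ → A →ₗ[K] A) : Prop where
  higher : IsHigherDerivation D
  bracket : ∀ m a b, D m (P a b) = ∑ i ∈ Finset.range (m + 1),
    (P (D i a) (D (m - i) b) + i • (α (D (m - i) a) * D i b - D i a * α (D (m - i) b)))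
  comm : ∀ i a, D i (α a) = α (D i a) + ((i : K) * η) • D i a

end HigherDerivation

/-- The subalgebra `B` of the Poisson algebra `F` is the Poisson affine space
`K_lam[T_1, ..., T_n]`: it is a Poisson subalgebra, it is the polynomial algebra in the `T i`,
and `{T i, T j} = lam i j * T i * T j` for the skew-symmetric matrix `lam`. -/
structure IsPoissonAffineSpace {K F : Type*} [Field K] [Field F] [Algebra K F] {n : ℕ}
    (P : PoissonBracket K F) (B : Subalgebra K F) (lam : Matrix (Fin n) (Fin n) K)
    (T : Fin n → F) : Prop where
  lam_skew : ∀ i j, lam i j = - lam j i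
  lam_self : ∀ i, lam i i = 0
  algebraicIndependent : AlgebraicIndependent K T
  adjoin_eq : Algebra.adjoin K (Set.range T) = B
  isPoissonSubalgebra : P.IsPoissonSubalgebra B
  bracket : ∀ i j, P (T i) (T j) = lam i j • (T i * T j)

end PoissonBracket

section ClassP

/-- The subalgebra `K[X_l | l < i]` of `K[X_0, ..., X_{n-1}]`. -/
abbrev polyBelow (K : Type*) [Field K] {n : ℕ} (i : Fin n) :
    Subalgebra K (MvPolynomial (Fin n) K) :=
  MvPolynomial.supported K {l | l < i}

/-- The variable `X_l` as an element of `K[X_l | l < i]`. -/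
def varBelow (K : Type*) [Field K] {n : ℕ} {l i : Fin n} (h : l < i) : polyBelow K i :=
  ⟨X l, MvPolynomial.X_mem_supported.mpr h⟩

/-- The inclusion of `K[X_l | l < j]` in `K[X_l | l < i]` for `j < i`. -/
def inclBelow (K : Type*) [Field K] {n : ℕ} {j i : Fin n} (h : j < i) :
    polyBelow K j →ₐ[K] polyBelow K i :=
  Subalgebra.inclusion (MvPolynomial.supported_mono fun _ hl => lt_trans hl h)

/-- A derivation that multiplies each variable by a scalar preserves the smaller polynomial
algebras. -/
theorem diag_mem_polyBelow {K : Type*} [Field K] {n : ℕ} {j i : Fin n} (h : j < i)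
    (d : Derivation K (polyBelow K i) (polyBelow K i)) (c : Fin n → K)
    (hd : ∀ l (hl : l < i), d (varBelow K hl) = c l • varBelow K hl) (a : polyBelow K j) :
    (d (inclBelow K h a) : MvPolynomial (Fin n) K) ∈ polyBelow K j := by
  obtain ⟨a, ha⟩ := a
  induction ha using Algebra.adjoin_induction with
  | mem x hx =>
    obtain ⟨l, hl, rfl⟩ := hx
    have e := hd l (lt_trans hl h)
    change (d (varBelow K (lt_trans hl h)) : MvPolynomial (Fin n) K) ∈ polyBelow K j
    rw [e]
    exact Subalgebra.smul_mem _ (MvPolynomial.X_mem_supported.mpr hl) _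
  | algebraMap r =>
    change (d (algebraMap K (polyBelow K i) r) : MvPolynomial (Fin n) K) ∈ polyBelow K j
    rw [d.map_algebraMap]
    exact Subalgebra.zero_mem _
  | add x y hx hy h1 h2 =>
    have e : inclBelow K h ⟨x + y, Subalgebra.add_mem _ hx hy⟩
        = inclBelow K h ⟨x, hx⟩ + inclBelow K h ⟨y, hy⟩ := rfl
    rw [e, map_add]
    exact Subalgebra.add_mem _ h1 h2
  | mul x y hx hy h1 h2 =>
    have e : inclBelow K h ⟨x * y, Subalgebra.mul_mem _ hx hy⟩
        = inclBelow K h ⟨x, hx⟩ * inclBelow K h ⟨y, hy⟩ := rfl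
    rw [e, d.leibniz]
    exact Subalgebra.add_mem _ (Subalgebra.mul_mem _ hx h2) (Subalgebra.mul_mem _ hy h1)

/-- An iterated Poisson-Ore extension `K[X_0][X_1; α_1, δ_1]_P ⋯ [X_{n-1}; α_{n-1}, δ_{n-1}]_P`:
a Poisson bracket on the polynomial algebra for which every `K[X_l | l < i]` is a Poisson
subalgebra, with `{X_i, a} = α_i(a) X_i + δ_i(a)` for `a` in `K[X_l | l < i]`, where `α_i` is a
Poisson derivation and `δ_i` a Poisson `α_i`-derivation of `K[X_l | l < i]`.
(For `i = 0` this algebra is `K`, and `α_0 = δ_0 = 0`.) -/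
structure IteratedPoissonOre (K : Type*) [Field K] (n : ℕ) where
  bracket : PoissonBracket K (MvPolynomial (Fin n) K)
  α : ∀ i : Fin n, Derivation K (polyBelow K i) (polyBelow K i)
  δ : ∀ i : Fin n, Derivation K (polyBelow K i) (polyBelow K i)
  closed : ∀ i, bracket.IsPoissonSubalgebra (polyBelow K i)
  α_poisson : ∀ i, (bracket.restrict _ (closed i)).IsPoissonDerivation (α i)
  δ_poisson : ∀ i, (bracket.restrict _ (closed i)).IsPoissonAlphaDerivation (α i) (δ i)
  bracket_X : ∀ i (a : polyBelow K i),
    bracket (X i) (a : MvPolynomial (Fin n) K) = (α i a : MvPolynomial (Fin n) K) * X i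
      + (δ i a : MvPolynomial (Fin n) K)

/-- The class of iterated Poisson-Ore extensions to which the Poisson deleting derivations
algorithm applies. The conditions on `δ_i`, `η_i` and `D_{i,k}` concern the indices `i ≠ 0`
only. -/
structure DeletingClass (K : Type*) [Field K] (n : ℕ) extends IteratedPoissonOre K n where
  lam : Matrix (Fin n) (Fin n) K
  lam_skew : ∀ i j, lam i j = - lam j i
  lam_self : ∀ i, lam i i = 0
  α_X : ∀ i l (hl : l < i), α i (varBelow K hl) = lam i l • varBelow K hl
  η : Fin n → K
  η_ne_zero : ∀ i : Fin n, 0 < (i : ℕ) → η i ≠ 0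
  D : ∀ i : Fin n, ℕ → polyBelow K i →ₗ[K] polyBelow K i
  D_one : ∀ i : Fin n, 0 < (i : ℕ) → ∀ a, D i 1 a = δ i a
  D_iterative : ∀ i : Fin n, 0 < (i : ℕ) → PoissonBracket.IsIterative (D i)
  D_locallyNilpotent : ∀ i : Fin n, 0 < (i : ℕ) → PoissonBracket.IsLocallyNilpotent (D i)
  D_skewPoisson : ∀ i : Fin n, 0 < (i : ℕ) →
    (bracket.restrict _ (closed i)).IsHigherSkewPoisson (η i) (α i) (D i)
  /-- `α_i D_{j,k} = D_{j,k} α_i + k λ_{ij} D_{j,k}` on `K[X_l | l < j]` for `0 < j < i`. -/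
  α_D : ∀ (i j : Fin n) (h : j < i), 0 < (j : ℕ) → ∀ (k : ℕ) (a : polyBelow K j),
    α i (inclBelow K h (D j k a)) = inclBelow K h
      (D j k ⟨α i (inclBelow K h a), diag_mem_polyBelow h (α i) (lam i) (α_X i) a⟩
        + ((k : K) * lam i j) • D j k a)

namespace DeletingClass

variable {K : Type*} [Field K] {n : ℕ} (H : DeletingClass K n)
  (F : Type*) [Field F] [Algebra K F] [Algebra (MvPolynomial (Fin n) K) F]

/-- One step of the algorithm, for the variable `j`: from `U` to `V` with `V i = U i` for `i ≥ j`
and `V i = ∑_k η_j^{-k} D_{j,k}(U i) (U j)^{-k}` for `i < j`. Here `D_{j,k}` acts on polynomials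
in the `U l`, `l < j`, as it does on polynomials in the `X l`, that is, `D_{j,k}(U i)` is the
value at `U` of the polynomial `D_{j,k}(X i)`. The sum has finitely many nonzero terms. -/
def step (j : Fin n) (U : Fin n → F) : Fin n → F := fun i =>
  if h : i < j then
    ∑ᶠ k : ℕ, ((H.η j)⁻¹ ^ k) •
      (aeval U (H.D j k (varBelow K h) : MvPolynomial (Fin n) K) * ((U j)⁻¹ ^ k))
  else U i

/-- The sequences of the algorithm, in the fraction field `F`: `stage n` is `(X_0, ..., X_{n-1})`
and `stage j` is obtained from `stage (j + 1)` by the step for the variable `j`, `j < n`.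
The algorithm ends at `stage 1`. -/
def stage (j : ℕ) : Fin n → F :=
  if h : j < n then H.step F ⟨j, h⟩ (stage (j + 1))
  else fun i => algebraMap (MvPolynomial (Fin n) K) F (X i)
termination_by n - j

/-- The subalgebra of `F` generated by `stage j`. -/
def stageAlg (j : ℕ) : Subalgebra K F := Algebra.adjoin K (Set.range (H.stage F j))

end DeletingClass

/-- The set `C S⁻¹` of fractions in the field `F`. -/
def fractionSet {K F : Type*} [Field K] [Field F] [Algebra K F] (C : Subalgebra K F)
    (S : Submonoid F) : Set F :=
  {f | ∃ c ∈ C, ∃ s ∈ S, f = c / s}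

end ClassP

end

noncomputable section

/-! One step at the variable `j`, with `x = U j`, is the map `θ = ∑ D_k t^k` with `t = η⁻¹ x⁻¹`,
applied to the variables below `j`. It is an algebra homomorphism because `D` is a higher
derivation, and iterativity makes it invertible: `a = ∑ θ(D_k a) (-t)^k`. Only powers of `x` occur
in denominators, so both algebras have the same localization at `x` and the same fraction field;
algebraic independence then follows by counting transcendence degree.

For the brackets, the choice of `t` matters because `η t x = 1`: all terms involving `δ` telescope.
Thus `{x, θ(a)} = θ(α(a)) x` (`bracket_x_deletingMap`), while `θ` itself preserves brackets
(`bracket_deletingMap`). For a later variable `y`, the weight of `D_k(a)` is shifted by exactly the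
opposite of that of `t^k` (`bracket_deletingMap_of_weight`).

These facts form the invariant `StageProperties`: the original brackets persist below `m`, and
brackets whose larger index is at least `m` are quadratic. A step lowers `m` by one
(`StageProperties.step`); at `m = 1` every bracket of two distinct generators is quadratic. -/

theorem sum_range_product_eq_sum_antidiagonal {M : Type*} [AddCommMonoid M] (N : ℕ)
    (f : ℕ → ℕ → M) (h₁ : ∀ k l, N ≤ k → f k l = 0) (h₂ : ∀ k l, N ≤ l → f k l = 0) :
    ∑ k ∈ Finset.range N, ∑ l ∈ Finset.range N, f k l
      = ∑ m ∈ Finset.range (2 * N), ∑ p ∈ Finset.HasAntidiagonal.antidiagonal m, f p.1 p.2 := by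
  rw [← Finset.sum_product',
    ← Finset.sum_fiberwise_of_maps_to (t := Finset.range (2 * N)) (g := fun p => p.1 + p.2)
      (fun p hp => by
        simp only [Finset.mem_product, Finset.mem_range] at hp ⊢
        omega)]
  -- Points of the antidiagonal outside the square contribute zero by `h₁` and `h₂`.
  refine Finset.sum_congr rfl fun m _ => Finset.sum_subset (fun p hp => ?_) fun p hp hp' => ?_
  · simpa using (Finset.mem_filter.mp hp).2
  · simp only [Finset.HasAntidiagonal.mem_antidiagonal] at hp
    simp only [Finset.mem_filter, Finset.mem_product, Finset.mem_range, hp, and_true,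
      not_and_or, not_lt] at hp'
    exact hp'.elim (h₁ _ _) (h₂ _ _)

namespace PoissonBracket

/-! ### Elementary bracket rules -/

section Basic

variable {K A : Type*} [CommRing K] [CommRing A] [Algebra K A] (P : PoissonBracket K A)

theorem leibniz_left (a b c : A) : P (a * b) c = a * P b c + b * P a c := by
  rw [P.skew, P.leibniz', P.skew c a, P.skew c b]
  ring

theorem pow_right (a b : A) (k : ℕ) : P a (b ^ k) = k * b ^ (k - 1) * P a b := by
  have h := (P.ham a).leibniz_pow b k
  simp only [ham_apply, smul_eq_mul, nsmul_eq_mul] at h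
  rw [h, mul_assoc]

theorem pow_left (a b : A) (k : ℕ) : P (a ^ k) b = k * a ^ (k - 1) * P a b := by
  rw [P.skew, P.pow_right, P.skew b a]
  ring

theorem algebraMap_right (a : A) (r : K) : P a (algebraMap K A r) = 0 :=
  (P.ham a).map_algebraMap r

theorem sum_left {ι : Type*} (s : Finset ι) (f : ι → A) (b : A) :
    P (∑ i ∈ s, f i) b = ∑ i ∈ s, P (f i) b := by
  simp

/-- The subalgebra generated by a set is a Poisson subalgebra if it contains the brackets of the
generators. -/
theorem isPoissonSubalgebra_adjoin {s : Set A}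
    (h : ∀ a ∈ s, ∀ b ∈ s, P a b ∈ Algebra.adjoin K s) :
    P.IsPoissonSubalgebra (Algebra.adjoin K s) := by
  have key : ∀ a, (∀ b ∈ s, P a b ∈ Algebra.adjoin K s) → ∀ b ∈ Algebra.adjoin K s,
      P a b ∈ Algebra.adjoin K s := fun a ha b hb => by
    induction hb using Algebra.adjoin_induction with
    | mem x hx => exact ha x hx
    | algebraMap r => rw [P.algebraMap_right]; exact Subalgebra.zero_mem _
    | add x y hx hy h1 h2 => rw [map_add]; exact Subalgebra.add_mem _ h1 h2
    | mul x y hx hy h1 h2 =>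
      rw [P.leibniz']
      exact Subalgebra.add_mem _ (Subalgebra.mul_mem _ hx h2) (Subalgebra.mul_mem _ h1 hy)
  refine fun a ha b hb => key a (fun c hc => ?_) b hb
  rw [P.skew]
  exact Subalgebra.neg_mem _ (key c (h c hc) a ha)

end Basic

/-! ### The deleting homomorphism and its inverse -/

section DeletingMap

variable {K A F : Type*} [Field K] [CommRing A] [Algebra K A] [Field F] [Algebra K F]
  {D : ℕ → A →ₗ[K] A}

/-- A common truncation bound turns identities between several `finsum`s into identities of sums
over one range. -/
theorem IsLocallyNilpotent.exists_common (hD : IsLocallyNilpotent D) (s : Finset A) :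
    ∃ N, ∀ a ∈ s, ∀ k, N ≤ k → D k a = 0 := by
  choose N hN using hD
  exact ⟨s.sup N, fun a ha k hk => hN a k ((Finset.le_sup ha).trans hk)⟩

/-- The map `a ↦ ∑_k D_k(a) t^k` with values in `F`. -/
def deletingMap (D : ℕ → A →ₗ[K] A) (ev : A →ₐ[K] F) (t : F) (a : A) : F :=
  ∑ᶠ k : ℕ, ev (D k a) * t ^ k

variable (ev : A →ₐ[K] F) (t : F)

theorem deletingMap_eq_sum {a : A} {N : ℕ} (hN : ∀ k, N ≤ k → D k a = 0) :
    deletingMap D ev t a = ∑ k ∈ Finset.range N, ev (D k a) * t ^ k := by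
  refine finsum_eq_sum_of_support_subset _ fun k hk => ?_
  by_contra h
  simp only [Finset.coe_range, Set.mem_Iio, not_lt] at h
  exact hk (by simp [hN k h])

theorem deletingMap_add (hD : IsLocallyNilpotent D) (a b : A) :
    deletingMap D ev t (a + b) = deletingMap D ev t a + deletingMap D ev t b := by
  classical
  obtain ⟨N, hN⟩ := hD.exists_common {a, b, a + b}
  rw [deletingMap_eq_sum ev t (hN a (by simp)), deletingMap_eq_sum ev t (hN b (by simp)),
    deletingMap_eq_sum ev t (hN (a + b) (by simp)), ← Finset.sum_add_distrib]
  simp [add_mul]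

theorem deletingMap_smul (hD : IsLocallyNilpotent D) (r : K) (a : A) :
    deletingMap D ev t (r • a) = r • deletingMap D ev t a := by
  classical
  obtain ⟨N, hN⟩ := hD.exists_common {a, r • a}
  rw [deletingMap_eq_sum ev t (hN a (by simp)), deletingMap_eq_sum ev t (hN (r • a) (by simp)),
    Finset.smul_sum]
  simp

/-- This is the Cauchy product: the coefficient of `t^m` is the Leibniz rule for `D m`. -/
theorem deletingMap_mul (hD : IsLocallyNilpotent D) (h : IsHigherDerivation D) (a b : A) :
    deletingMap D ev t (a * b) = deletingMap D ev t a * deletingMap D ev t b := by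
  classical
  obtain ⟨N, hN⟩ := hD.exists_common {a, b, a * b}
  rw [deletingMap_eq_sum ev t (hN a (by simp)), deletingMap_eq_sum ev t (hN b (by simp)),
    deletingMap_eq_sum ev t (N := 2 * N) (fun k hk => hN (a * b) (by simp) k (by omega)),
    Finset.sum_mul_sum, sum_range_product_eq_sum_antidiagonal]
  · refine Finset.sum_congr rfl fun m _ => ?_
    rw [h.mul, ← Finset.Nat.sum_antidiagonal_eq_sum_range_succ (fun i j => D i a * D j b), map_sum,
      Finset.sum_mul]
    refine Finset.sum_congr rfl fun p hp => ?_
    rw [← Finset.HasAntidiagonal.mem_antidiagonal.mp hp, map_mul]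
    ring
  · intro k l hk
    rw [hN a (by simp) k hk, map_zero, zero_mul, zero_mul]
  · intro k l hl
    rw [hN b (by simp) l hl, map_zero, zero_mul, mul_zero]

theorem IsHigherDerivation.apply_one (h : IsHigherDerivation D) {m : ℕ} (hm : 0 < m) :
    D m 1 = 0 := by
  induction m using Nat.strong_induction_on with
  | _ m ih =>
    have h1 := h.mul m 1 1
    obtain ⟨k, rfl⟩ : ∃ k, m = k + 1 := ⟨m - 1, by omega⟩
    -- Only the two end terms survive, so `D m 1 = 2 * D m 1`, which forces zero in any
    -- characteristic.
    rw [mul_one, Finset.sum_range_succ, Finset.sum_range_succ', Finset.sum_eq_zero] at h1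
    · simpa [h.zero] using h1
    · intro i hi
      rw [ih (i + 1) (by simpa using hi) (by omega), zero_mul]

theorem deletingMap_one (h : IsHigherDerivation D) : deletingMap D ev t 1 = 1 := by
  rw [deletingMap_eq_sum ev t (N := 1) fun k hk => h.apply_one hk]
  simp [h.zero]

/-- The map `a ↦ ∑_k D_k(a) t^k` as a homomorphism of algebras. -/
def deletingHom (hD : IsLocallyNilpotent D) (h : IsHigherDerivation D) : A →ₐ[K] F :=
  AlgHom.ofLinearMap
    { toFun := deletingMap D ev t
      map_add' := deletingMap_add ev t hD
      map_smul' := deletingMap_smul ev t hD }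
    (deletingMap_one ev t h) (deletingMap_mul ev t hD h)

@[simp] theorem deletingHom_apply (hD : IsLocallyNilpotent D) (h : IsHigherDerivation D) (a : A) :
    deletingHom ev t hD h a = deletingMap D ev t a := rfl

/-- The inversion formula: `a` is recovered from the images of the `D_k(a)`. -/
theorem ev_eq_sum_deletingMap (h : IsHigherDerivation D)
    (hi : IsIterative D) {a : A} {N : ℕ} (hN : ∀ k, N ≤ k → D k a = 0) :
    ev a = ∑ k ∈ Finset.range N, deletingMap D ev t (D k a) * (-t) ^ k := by
  -- `D l (D k a)` is a multiple of `D (l + k) a`, so the bound for `a` also serves all `D k a`.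
  have h0 : ∀ k l, N ≤ l → D l (D k a) = 0 := fun k l hl => by
    rw [hi, hN _ (by omega), smul_zero]
  simp only [fun k => deletingMap_eq_sum ev t (h0 k), Finset.sum_mul]
  rw [sum_range_product_eq_sum_antidiagonal (f := fun k l => ev (D l (D k a)) * t ^ l * (-t) ^ k)]
  · have key : ∀ m, ∑ p ∈ Finset.HasAntidiagonal.antidiagonal m, ev (D p.2 (D p.1 a)) * t ^ p.2 * (-t) ^ p.1
        = if m = 0 then ev a else 0 := fun m => by
      have e : ∀ p ∈ Finset.HasAntidiagonal.antidiagonal m, ev (D p.2 (D p.1 a)) * t ^ p.2 * (-t) ^ p.1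
          = ev (D m a) * (m.choose p.1 • ((-t) ^ p.1 * t ^ p.2)) := fun p hp => by
        have hp' := Finset.HasAntidiagonal.mem_antidiagonal.mp hp
        rw [hi, add_comm p.2, hp', Nat.choose_symm_of_eq_add hp'.symm]
        rw [map_nsmul]
        simp only [nsmul_eq_mul]
        ring
      rw [Finset.sum_congr rfl e, ← Finset.mul_sum,
        ← (Commute.all (-t) t).add_pow', neg_add_cancel]
      split_ifs with hm
      · simp [hm, h.zero]
      · simp [hm]
    rw [Finset.sum_congr rfl fun m _ => key m]
    rcases Nat.eq_zero_or_pos N with rfl | hpos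
    · have := hN 0 le_rfl
      rw [h.zero, LinearMap.id_apply] at this
      simp [this]
    · rw [Finset.sum_ite_eq' , if_pos (by simpa using hpos)]
  · intro k l hk
    simp [hN k hk]
  · intro k l hl
    simp [h0 k l hl]

/-- If `D k a = 0` for `k ≥ N`, the factor `x ^ N` clears every power of `x⁻¹` in the sum. -/
theorem deletingMap_mem {C : Subalgebra K F} {x : F} {η : K}
    (hev : ∀ a, ev a ∈ C) (hx : x ∈ C) (hx0 : x ≠ 0) (hD : IsLocallyNilpotent D) (a : A) :
    ∃ m : ℕ, deletingMap D ev (algebraMap K F η⁻¹ * x⁻¹) a * x ^ m ∈ C := by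
  obtain ⟨N, hN⟩ := hD a
  refine ⟨N, ?_⟩
  rw [deletingMap_eq_sum ev _ hN, Finset.sum_mul]
  refine Subalgebra.sum_mem _ fun k hk => ?_
  have hk := (Finset.mem_range.mp hk).le
  have e : ev (D k a) * (algebraMap K F η⁻¹ * x⁻¹) ^ k * x ^ N
      = ev (D k a) * algebraMap K F η⁻¹ ^ k * x ^ (N - k) := by
    rw [mul_pow, pow_sub₀ x hx0 hk, inv_pow]
    ring
  rw [e]
  exact Subalgebra.mul_mem _ (Subalgebra.mul_mem _ (hev _)
    (Subalgebra.pow_mem _ (Subalgebra.algebraMap_mem _ _) _)) (Subalgebra.pow_mem _ hx _)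

/-- The same clearing of denominators, applied to the inversion formula. -/
theorem ev_mem_of_deletingMap_mem {C : Subalgebra K F} {x : F} {η : K}
    (hC : ∀ a, deletingMap D ev (algebraMap K F η⁻¹ * x⁻¹) a ∈ C) (hx : x ∈ C) (hx0 : x ≠ 0)
    (hD : IsLocallyNilpotent D) (h : IsHigherDerivation D) (hi : IsIterative D) (a : A) :
    ∃ m : ℕ, ev a * x ^ m ∈ C := by
  obtain ⟨N, hN⟩ := hD a
  refine ⟨N, ?_⟩
  rw [ev_eq_sum_deletingMap ev (algebraMap K F η⁻¹ * x⁻¹) h hi hN, Finset.sum_mul]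
  refine Subalgebra.sum_mem _ fun k hk => ?_
  have hk := (Finset.mem_range.mp hk).le
  have e : deletingMap D ev (algebraMap K F η⁻¹ * x⁻¹) (D k a)
        * (-(algebraMap K F η⁻¹ * x⁻¹)) ^ k * x ^ N
      = deletingMap D ev (algebraMap K F η⁻¹ * x⁻¹) (D k a)
        * (- algebraMap K F η⁻¹) ^ k * x ^ (N - k) := by
    rw [pow_sub₀ x hx0 hk, ← neg_mul, mul_pow, inv_pow]
    ring
  rw [e]
  exact Subalgebra.mul_mem _ (Subalgebra.mul_mem _ (hC _) (Subalgebra.pow_mem _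
    (Subalgebra.neg_mem _ (Subalgebra.algebraMap_mem _ _)) _)) (Subalgebra.pow_mem _ hx _)

/-! ### Brackets of deleted elements -/

section Bracket

variable (P : PoissonBracket K A) (Q : PoissonBracket K F) {η : K} {x : F} {α : Derivation K A A}

/-- If `{y, D_k(a)} = (c + k d) D_k(a) y` for all `k` and `{y, t} = -d t y`, then
`{y, θ(a)} = c θ(a) y` for `θ = ∑_k D_k t^k`. -/
theorem bracket_deletingMap_of_weight (hD : IsLocallyNilpotent D) (a : A) (y : F) (c d : K)
    (hy : ∀ k : ℕ, Q y (ev (D k a)) = (c + k * d) • (ev (D k a) * y))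
    (ht : Q y t = - (d • (t * y))) :
    Q y (deletingMap D ev t a) = c • (deletingMap D ev t a * y) := by
  obtain ⟨N, hN⟩ := hD a
  rw [deletingMap_eq_sum ev t hN, map_sum, Finset.sum_mul, Finset.smul_sum]
  refine Finset.sum_congr rfl fun k _ => ?_
  -- The weight `k * d` carried by `D k a` cancels against the weight `-(k * d)` of `t ^ k`.
  rw [Q.leibniz', Q.pow_right, hy, ht]
  simp only [Algebra.smul_def, map_add, map_mul, map_natCast]
  rcases k with _ | k
  · simp
  · rw [Nat.add_sub_cancel]
    ring

/-- Obtained by applying `{y, -}` to `x * x⁻¹ = 1`. -/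
theorem bracket_inv (y : F) (hx0 : x ≠ 0) :
    Q y (algebraMap K F η⁻¹ * x⁻¹) = - (algebraMap K F η⁻¹ * x⁻¹ * x⁻¹ * Q y x) := by
  have h : Q y (x * x⁻¹) = 0 := by
    rw [mul_inv_cancel₀ hx0, ← map_one (algebraMap K F), Q.algebraMap_right]
  rw [Q.leibniz'] at h
  rw [Q.leibniz', Q.algebraMap_right, zero_mul, add_zero]
  have e : Q y x⁻¹ = x⁻¹ * (x * Q y x⁻¹) := by rw [inv_mul_cancel_left₀ hx0]
  rw [e]
  linear_combination algebraMap K F η⁻¹ * x⁻¹ * h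

/-- The passage from `a` to `θ(a)` absorbs the term `D 1`. Since `{x, t} = 0`, the `k`-th terms of
the two sides differ by `(k + 1) D_{k+1}(a) t^k - k η D_k(a) t^k x`; as `η t x = 1`, this is a
telescoping difference. -/
theorem bracket_x_deletingMap (hη : η ≠ 0) (hx0 : x ≠ 0) (hD : IsLocallyNilpotent D)
    (hi : IsIterative D)
    (hcomm : ∀ i a, D i (α a) = α (D i a) + ((i : K) * η) • D i a)
    (hx : ∀ a, Q x (ev a) = ev (α a) * x + ev (D 1 a)) (a : A) :
    Q x (deletingMap D ev (algebraMap K F η⁻¹ * x⁻¹) a)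
      = deletingMap D ev (algebraMap K F η⁻¹ * x⁻¹) (α a) * x := by
  classical
  set t := algebraMap K F η⁻¹ * x⁻¹ with ht
  have hηF : algebraMap K F η ≠ 0 := by simpa using hη
  have htx : algebraMap K F η * t * x = 1 := by
    rw [ht, map_inv₀]
    field_simp
  obtain ⟨N, hN⟩ := hD.exists_common {a, α a}
  have hQt : Q x t = 0 := by
    rw [ht, bracket_inv Q x hx0, Q.self', mul_zero, neg_zero]
  clear_value t
  have hNa := hN a (by simp)
  rw [deletingMap_eq_sum ev t hNa, deletingMap_eq_sum ev t (hN (α a) (by simp)), map_sum,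
    Finset.sum_mul, ← sub_eq_zero, ← Finset.sum_sub_distrib]
  have e : ∀ k ∈ Finset.range N, Q x (ev (D k a) * t ^ k) - ev (D k (α a)) * t ^ k * x
      = ((k + 1 : ℕ) * algebraMap K F η * ev (D (k + 1) a) * t ^ (k + 1) * x)
        - (k * algebraMap K F η * ev (D k a) * t ^ k * x) := fun k _ => by
    have h1 : D 1 (D k a) = (k + 1) • D (k + 1) a := by
      rw [hi, Nat.choose_one_right, add_comm 1 k]
    rw [Q.leibniz', Q.pow_right, hQt, hx, hcomm, h1]
    simp only [map_add, map_smul, map_nsmul]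
    simp only [Algebra.smul_def, map_mul, map_natCast]
    push_cast
    linear_combination - ((k : F) + 1) * ev (D (k + 1) a) * t ^ k * htx
  rw [Finset.sum_congr rfl e, Finset.sum_range_sub
    (fun k => (k : F) * algebraMap K F η * ev (D k a) * t ^ k * x)]
  simp [hNa N le_rfl]

/-- The map `∑_k D_k t^k` preserves the brackets. -/
theorem bracket_deletingMap (hη : η ≠ 0) (hx0 : x ≠ 0) (hD : IsLocallyNilpotent D)
    (hi : IsIterative D) (h : IsHigherSkewPoisson P η α D)
    (hev : ∀ a b, Q (ev a) (ev b) = ev (P a b))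
    (hx : ∀ a, Q x (ev a) = ev (α a) * x + ev (D 1 a)) (a b : A) :
    Q (deletingMap D ev (algebraMap K F η⁻¹ * x⁻¹) a)
      (deletingMap D ev (algebraMap K F η⁻¹ * x⁻¹) b)
      = deletingMap D ev (algebraMap K F η⁻¹ * x⁻¹) (P a b) := by
  classical
  set t := algebraMap K F η⁻¹ * x⁻¹ with ht
  have hηF : algebraMap K F η ≠ 0 := by simpa using hη
  have htx : algebraMap K F η * t * x = 1 := by
    rw [ht, map_inv₀]
    field_simp
  have hxt : x⁻¹ = algebraMap K F η * t := by
    rw [ht, map_inv₀]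
    field_simp
  obtain ⟨N, hN⟩ := hD.exists_common {a, b, P a b}
  have hNa := hN a (by simp)
  have hNb := hN b (by simp)
  -- the bracket of `ev c` with `t`
  have hct : ∀ c, Q (ev c) t = t * ev (α c) + algebraMap K F η * t ^ 2 * ev (D 1 c) := fun c => by
    rw [ht, bracket_inv Q _ hx0, Q.skew, hx, ← ht, hxt]
    linear_combination t * ev (α c) * htx
  clear_value t
  have hD1 : ∀ k c, D 1 (D k c) = (k + 1) • D (k + 1) c := fun k c => by
    rw [hi, Nat.choose_one_right, add_comm 1 k]
  have hpow : ∀ k : ℕ, (k : F) * t ^ (k - 1) * t = k * t ^ k := fun k => by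
    rcases k with _ | k
    · simp
    · rw [Nat.add_sub_cancel]; ring
  set f : ℕ → ℕ → F := fun k l => (Q (ev (D k a)) (ev (D l b))
    + (l * ev (α (D k a)) * ev (D l b) - k * ev (D k a) * ev (α (D l b)))) * t ^ (k + l) with hf
  set u : ℕ → F := fun k => k * ev (D k a) * t ^ k with hu
  set v : ℕ → F := fun k => k * ev (D k b) * t ^ k with hv
  -- Shifting the index does not change a sum whose boundary terms vanish.
  have hsum : ∀ w : ℕ → F, w 0 = 0 → w N = 0 →
      ∑ k ∈ Finset.range N, w (k + 1) = ∑ k ∈ Finset.range N, w k := fun w h0 h1 => by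
    have := Finset.sum_range_sub w N
    rw [Finset.sum_sub_distrib, h0, h1, sub_zero, sub_eq_zero] at this
    exact this
  -- Here `f k l` is the `(k, l)` contribution to the bracket axiom for `D (k + l)`. The rest comes
  -- from the `D 1` part of `hct`, and by `hsum` its double sum cancels.
  have e : ∀ k l, Q (ev (D k a) * t ^ k) (ev (D l b) * t ^ l)
      = f k l + algebraMap K F η * (u (k + 1) * v l - u k * v (l + 1)) := fun k l => by
    have htt : Q t t = 0 := Q.self' t
    rw [Q.leibniz', Q.leibniz_left, Q.leibniz_left, Q.pow_left, Q.pow_right, Q.pow_right,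
      Q.pow_left, htt, Q.skew t, hct, hct, hD1, hD1]
    simp only [map_nsmul]
    simp only [hf, hu, hv, nsmul_eq_mul]
    push_cast
    linear_combination
      (ev (D l b) * t ^ k * ev (α (D k a))
        + ev (D l b) * t ^ k * algebraMap K F η * t * (k + 1) * ev (D (k + 1) a)) * hpow l
      - (ev (D k a) * t ^ l * ev (α (D l b))
        + ev (D k a) * t ^ l * algebraMap K F η * t * (l + 1) * ev (D (l + 1) b)) * hpow k
  rw [deletingMap_eq_sum ev t hNa, deletingMap_eq_sum ev t hNb,
    deletingMap_eq_sum ev t (N := 2 * N) (fun k hk => hN (P a b) (by simp) k (by omega)),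
    Q.sum_left]
  simp only [map_sum, e, Finset.sum_add_distrib]
  have hz : ∑ k ∈ Finset.range N, ∑ l ∈ Finset.range N,
      algebraMap K F η * (u (k + 1) * v l - u k * v (l + 1)) = 0 := by
    simp only [← Finset.mul_sum, Finset.sum_sub_distrib, ← Finset.sum_mul]
    rw [hsum u (by simp [hu]) (by simp [hu, hNa N le_rfl]),
      hsum v (by simp [hv]) (by simp [hv, hNb N le_rfl]), sub_self, mul_zero]
  rw [hz, add_zero, sum_range_product_eq_sum_antidiagonal]
  · refine Finset.sum_congr rfl fun m _ => ?_
    rw [h.bracket, ← Finset.Nat.sum_antidiagonal_eq_sum_range_succ (fun i j => P (D i a) (D j b)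
      + i • (α (D j a) * D i b - D i a * α (D j b)))]
    simp only [smul_sub, ← add_sub_assoc, Finset.sum_add_distrib, Finset.sum_sub_distrib]
    -- In this term of the axiom the index `i` belongs to `b`; the swap makes the second index
    -- belong to `b`, as in `f`.
    rw [← Finset.Nat.sum_antidiagonal_swap (f := fun p => p.1 • (α (D p.2 a) * D p.1 b)),
      ← Finset.sum_add_distrib, ← Finset.sum_sub_distrib, map_sum, Finset.sum_mul]
    refine Finset.sum_congr rfl fun p hp => ?_
    simp only [hf, Prod.fst_swap, Prod.snd_swap, map_add, map_sub, map_nsmul, map_mul, hev]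
    simp only [nsmul_eq_mul, Finset.HasAntidiagonal.mem_antidiagonal.mp hp]
    ring
  · intro k l hk
    simp [hf, hNa k hk]
  · intro k l hl
    simp [hf, hNb l hl]

end Bracket

end DeletingMap

end PoissonBracket

/-! ### Polynomial evaluations, denominators and transcendence degree -/

open PoissonBracket

variable {K : Type*} [Field K] {n : ℕ}

theorem polyBelow_algHom_ext {B : Type*} [Semiring B] [Algebra K B] {j : Fin n}
    {f g : polyBelow K j →ₐ[K] B} (h : ∀ l (hl : l < j), f (varBelow K hl) = g (varBelow K hl)) :
    f = g := by
  refine AlgHom.adjoin_ext ?_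
  rintro _ ⟨l, hl, rfl⟩
  exact h l hl

/-- If `{y, f(X_l)} = f(d(X_l)) y` for all variables, then `{y, f(a)} = f(d(a)) y` for all `a`. -/
theorem bracket_eq_of_vars {F : Type*} [CommRing F] [Algebra K F] (Q : PoissonBracket K F)
    {j : Fin n} (f : polyBelow K j →ₐ[K] F) (d : Derivation K (polyBelow K j) (polyBelow K j))
    (y : F) (h : ∀ l (hl : l < j), Q y (f (varBelow K hl)) = f (d (varBelow K hl)) * y)
    (a : polyBelow K j) : Q y (f a) = f (d a) * y := by
  obtain ⟨a, ha⟩ := a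
  induction ha using Algebra.adjoin_induction with
  | mem x hx =>
    obtain ⟨l, hl, rfl⟩ := hx
    exact h l hl
  | algebraMap r =>
    change Q y (f (algebraMap K (polyBelow K j) r)) = f (d (algebraMap K (polyBelow K j) r)) * y
    rw [AlgHom.commutes, Q.algebraMap_right, d.map_algebraMap, map_zero, zero_mul]
  | add a b ha hb h1 h2 =>
    have e : (⟨a + b, Subalgebra.add_mem _ ha hb⟩ : polyBelow K j) = ⟨a, ha⟩ + ⟨b, hb⟩ := rfl
    rw [e, map_add, map_add, map_add, map_add, h1, h2, add_mul]
  | mul a b ha hb h1 h2 =>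
    have e : (⟨a * b, Subalgebra.mul_mem _ ha hb⟩ : polyBelow K j) = ⟨a, ha⟩ * ⟨b, hb⟩ := rfl
    rw [e, map_mul, Q.leibniz', h1, h2, d.leibniz]
    simp only [map_add, map_mul, smul_eq_mul]
    ring

theorem mem_adjoin_range {F ι : Type*} [CommRing F] [Algebra K F] (U : ι → F) (i : ι) :
    U i ∈ Algebra.adjoin K (Set.range U) :=
  Algebra.subset_adjoin ⟨i, rfl⟩

theorem aeval_mem_adjoin_range {F ι : Type*} [CommRing F] [Algebra K F] (U : ι → F)
    (p : MvPolynomial ι K) : aeval U p ∈ Algebra.adjoin K (Set.range U) := by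
  rw [Algebra.adjoin_range_eq_range_aeval]
  exact ⟨p, rfl⟩

/-- Because `x ∈ C`, the elements carried into `C` by some power of `x` form a subalgebra, so
generators suffice. -/
theorem exists_mul_pow_mem_of_mem_adjoin {F : Type*} [CommRing F] [Algebra K F]
    {s : Set F} {C : Subalgebra K F} {x : F} (hx : x ∈ C)
    (h : ∀ a ∈ s, ∃ m : ℕ, a * x ^ m ∈ C) {a : F} (ha : a ∈ Algebra.adjoin K s) :
    ∃ m : ℕ, a * x ^ m ∈ C := by
  induction ha using Algebra.adjoin_induction with
  | mem a ha => exact h a ha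
  | algebraMap r => exact ⟨0, by simp⟩
  | add a b _ _ h1 h2 =>
    obtain ⟨k, hk⟩ := h1
    obtain ⟨l, hl⟩ := h2
    refine ⟨k + l, ?_⟩
    rw [show (a + b) * x ^ (k + l) = a * x ^ k * x ^ l + b * x ^ l * x ^ k by ring]
    exact C.add_mem (C.mul_mem hk (C.pow_mem hx _)) (C.mul_mem hl (C.pow_mem hx _))
  | mul a b _ _ h1 h2 =>
    obtain ⟨k, hk⟩ := h1
    obtain ⟨l, hl⟩ := h2
    refine ⟨k + l, ?_⟩
    rw [show a * b * x ^ (k + l) = a * x ^ k * (b * x ^ l) by ring]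
    exact C.mul_mem hk hl

theorem fractionSet_subset {F : Type*} [Field F] [Algebra K F] {C C' : Subalgebra K F} {x : F}
    (hx0 : x ≠ 0) (h : ∀ a ∈ C, ∃ m : ℕ, a * x ^ m ∈ C') :
    fractionSet C (Submonoid.powers x) ⊆ fractionSet C' (Submonoid.powers x) := by
  rintro _ ⟨c, hc, _, ⟨k, rfl⟩, rfl⟩
  obtain ⟨m, hm⟩ := h c hc
  refine ⟨_, hm, x ^ (k + m), ⟨k + m, rfl⟩, ?_⟩
  change c / x ^ k = _
  rw [pow_add, mul_div_mul_right _ _ (pow_ne_zero _ hx0)]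

theorem isFractionRing_subalgebra {F : Type*} [Field F] [Algebra K F] {C : Subalgebra K F}
    (h : ∀ f : F, ∃ c ∈ C, ∃ d ∈ C, f = c / d) : IsFractionRing C F := by
  refine IsFractionRing.of_field C F fun f => ?_
  obtain ⟨c, hc, d, hd, e⟩ := h f
  exact ⟨⟨c, hc⟩, ⟨d, hd⟩, e⟩

/-- A family of `n` elements that generates the field `F` is algebraically independent if `F`
has `n` algebraically independent elements. -/
theorem algebraicIndependent_of_isFractionRing {F ι : Type*} [Finite ι] [Field F] [Algebra K F]
    {U V : ι → F} (hU : AlgebraicIndependent K U)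
    (hV : IsFractionRing (Algebra.adjoin K (Set.range V)) F) : AlgebraicIndependent K V := by
  have : Algebra.IsAlgebraic (Algebra.adjoin K (Set.range V)) F :=
    IsLocalization.isAlgebraic _ (nonZeroDivisors (Algebra.adjoin K (Set.range V)))
  -- `F` is algebraic over `K[V]`, and `U` shows that the transcendence degree is at least the size
  -- of the index set; so `V` has no redundancy.
  exact (Algebra.IsAlgebraic.isTranscendenceBasis_of_lift_le_trdeg_of_finite K V
    hU.lift_cardinalMk_le_trdeg).1

/-! ### The invariant of the algorithm -/

namespace DeletingClass

variable (H : DeletingClass K n) {F : Type*} [Field F] [Algebra K F]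

/-- The properties of the sequences of the algorithm: below `m`, the brackets are those of the
original variables; the other brackets are quadratic. -/
structure StageProperties (Q : PoissonBracket K F) (m : ℕ) (U : Fin n → F) : Prop where
  indep : AlgebraicIndependent K U
  bracket_below : ∀ a ∈ supported K {l : Fin n | (l : ℕ) < m},
    ∀ b ∈ supported K {l : Fin n | (l : ℕ) < m},
      Q (aeval U a) (aeval U b) = aeval U (H.bracket a b)
  bracket_above : ∀ i l : Fin n, m ≤ i → l < i → Q (U i) (U l) = H.lam i l • (U i * U l)
  exists_div : ∀ f : F, ∃ c ∈ Algebra.adjoin K (Set.range U),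
    ∃ d ∈ Algebra.adjoin K (Set.range U), f = c / d

variable {H} {Q : PoissonBracket K F}

theorem StageProperties.ne_zero {m : ℕ} {U : Fin n → F} (hU : H.StageProperties Q m U)
    (i : Fin n) : U i ≠ 0 := hU.indep.ne_zero i

theorem StageProperties.isPoissonSubalgebra {m : ℕ} {U : Fin n → F}
    (hU : H.StageProperties Q m U) :
    Q.IsPoissonSubalgebra (Algebra.adjoin K (Set.range U)) := by
  have key : ∀ i l : Fin n, l < i → Q (U i) (U l) ∈ Algebra.adjoin K (Set.range U) :=
    fun i l hl => by
    rcases le_or_gt m (i : ℕ) with h | h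
    · rw [hU.bracket_above i l h hl]
      exact Subalgebra.smul_mem _
        (Subalgebra.mul_mem _ (mem_adjoin_range U i) (mem_adjoin_range U l)) _
    · have e := hU.bracket_below (X i) (X_mem_supported.mpr h) (X l)
        (X_mem_supported.mpr (lt_trans (Fin.lt_def.mp hl) h))
      rw [aeval_X, aeval_X] at e
      rw [e]
      exact aeval_mem_adjoin_range U _
  refine Q.isPoissonSubalgebra_adjoin ?_
  rintro _ ⟨i, rfl⟩ _ ⟨l, rfl⟩
  rcases lt_trichotomy i l with h | rfl | h
  · rw [Q.skew]
    exact Subalgebra.neg_mem _ (key l i h)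
  · rw [Q.self']
    exact Subalgebra.zero_mem _
  · exact key i l h

/-- The evaluation at `U` of the polynomials in the variables below `j`. -/
def evalBelow (U : Fin n → F) (j : Fin n) : polyBelow K j →ₐ[K] F :=
  (aeval U).comp (polyBelow K j).val

theorem evalBelow_apply (U : Fin n → F) (j : Fin n) (a : polyBelow K j) :
    evalBelow U j a = aeval U (a : MvPolynomial (Fin n) K) := rfl

@[simp] theorem evalBelow_varBelow (U : Fin n → F) {l j : Fin n} (h : l < j) :
    evalBelow U j (varBelow K h) = U l := aeval_X U l

theorem evalBelow_inclBelow (U : Fin n → F) {j i : Fin n} (h : j < i) (a : polyBelow K j) :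
    evalBelow U i (inclBelow K h a) = evalBelow U j a := by
  rw [evalBelow_apply, evalBelow_apply, inclBelow, Subalgebra.coe_inclusion]

theorem evalBelow_mem_adjoin_range (U : Fin n → F) (j : Fin n) (a : polyBelow K j) :
    evalBelow U j a ∈ Algebra.adjoin K (Set.range U) := by
  rw [evalBelow_apply]
  exact aeval_mem_adjoin_range U _

namespace StageProperties

variable {m : ℕ} {U : Fin n → F} {i : Fin n}

theorem bracket_evalBelow_of_ge (hU : H.StageProperties Q m U) (hi : m ≤ i) (a : polyBelow K i) :
    Q (U i) (evalBelow U i a) = evalBelow U i (H.α i a) * U i :=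
  bracket_eq_of_vars Q _ _ _ (fun l hl => by
    rw [H.α_X, map_smul, evalBelow_varBelow, hU.bracket_above i l hi hl, smul_mul_assoc,
      mul_comm (U l)]) a

theorem bracket_evalBelow_of_lt (hU : H.StageProperties Q m U) (hi : (i : ℕ) < m)
    (a : polyBelow K i) :
    Q (U i) (evalBelow U i a) = evalBelow U i (H.α i a) * U i + evalBelow U i (H.δ i a) := by
  have e := hU.bracket_below (X i) (X_mem_supported.mpr hi) a
    (supported_mono (fun l hl => (Fin.lt_def.mp hl).trans hi) a.2)
  rw [aeval_X, H.bracket_X, map_add, map_mul, aeval_X] at e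
  simpa only [evalBelow_apply] using e

theorem bracket_evalBelow_evalBelow (hU : H.StageProperties Q m U) (hi : (i : ℕ) < m)
    (a b : polyBelow K i) : Q (evalBelow U i a) (evalBelow U i b)
      = evalBelow U i (H.bracket.restrict _ (H.closed i) a b) := by
  have hs : polyBelow K i ≤ supported K {l : Fin n | (l : ℕ) < m} :=
    supported_mono fun l hl => (Fin.lt_def.mp hl).trans hi
  have e := hU.bracket_below a (hs a.2) b (hs b.2)
  simpa only [evalBelow_apply, restrict_apply] using e

end StageProperties

/-! ### One step preserves the invariant -/

section Step

variable (H) (U : Fin n → F) (j : Fin n)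

/-- The element `η_j⁻¹ U_j⁻¹`. -/
def stepParam : F := algebraMap K F (H.η j)⁻¹ * (U j)⁻¹

theorem step_of_lt {i : Fin n} (h : i < j) : H.step F j U i
    = deletingMap (H.D j) (evalBelow U j) (H.stepParam U j) (varBelow K h) := by
  rw [step, dif_pos h]
  refine finsum_congr fun k => ?_
  rw [evalBelow_apply, stepParam, mul_pow, Algebra.smul_def, map_pow]
  ring

theorem step_of_not_lt {i : Fin n} (h : ¬ i < j) : H.step F j U i = U i := by
  rw [step, dif_neg h]

theorem step_self : H.step F j U j = U j := H.step_of_not_lt U j (lt_irrefl j)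

variable {j}

/-- Both sides are algebra homomorphisms in `a` that agree on the variables. Statements about the
new generators thereby become statements about `θ` on all of `polyBelow K j`. -/
theorem evalBelow_step (hj : 0 < (j : ℕ)) (a : polyBelow K j) : evalBelow (H.step F j U) j a
    = deletingMap (H.D j) (evalBelow U j) (H.stepParam U j) a := by
  have : evalBelow (H.step F j U) j = deletingHom (evalBelow U j) (H.stepParam U j)
      (H.D_locallyNilpotent j hj) (H.D_skewPoisson j hj).higher :=
    polyBelow_algHom_ext fun l hl => by
      rw [evalBelow_varBelow, H.step_of_lt U j hl, deletingHom_apply]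
  rw [this, deletingHom_apply]

variable {U}

theorem exists_mul_pow_mem_of_mem_step (hj : 0 < (j : ℕ)) (hx0 : U j ≠ 0) {a : F}
    (ha : a ∈ Algebra.adjoin K (Set.range (H.step F j U))) :
    ∃ m : ℕ, a * U j ^ m ∈ Algebra.adjoin K (Set.range U) := by
  refine exists_mul_pow_mem_of_mem_adjoin (mem_adjoin_range U j) ?_ ha
  rintro _ ⟨i, rfl⟩
  by_cases h : i < j
  · rw [H.step_of_lt U j h]
    exact deletingMap_mem _ (evalBelow_mem_adjoin_range U j) (mem_adjoin_range U j) hx0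
      (H.D_locallyNilpotent j hj) _
  · rw [H.step_of_not_lt U j h]
    exact ⟨0, by simpa using mem_adjoin_range U i⟩

theorem exists_mul_pow_mem_step (hj : 0 < (j : ℕ)) (hx0 : U j ≠ 0) {a : F}
    (ha : a ∈ Algebra.adjoin K (Set.range U)) :
    ∃ m : ℕ, a * U j ^ m ∈ Algebra.adjoin K (Set.range (H.step F j U)) := by
  have hx : U j ∈ Algebra.adjoin K (Set.range (H.step F j U)) := by
    have := mem_adjoin_range (K := K) (H.step F j U) j
    rwa [step_self] at this
  refine exists_mul_pow_mem_of_mem_adjoin hx ?_ ha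
  rintro _ ⟨i, rfl⟩
  by_cases h : i < j
  · rw [← evalBelow_varBelow (K := K) U h]
    refine ev_mem_of_deletingMap_mem (η := H.η j) _ (fun a => ?_) hx hx0
      (H.D_locallyNilpotent j hj) (H.D_skewPoisson j hj).higher (H.D_iterative j hj) _
    have e := H.evalBelow_step U hj a
    rw [stepParam] at e
    rw [← e]
    exact evalBelow_mem_adjoin_range _ _ _
  · refine ⟨0, ?_⟩
    rw [pow_zero, mul_one, ← H.step_of_not_lt U j h]
    exact mem_adjoin_range _ i

theorem fractionSet_step (hj : 0 < (j : ℕ)) (hx0 : U j ≠ 0) :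
    fractionSet (Algebra.adjoin K (Set.range (H.step F j U))) (Submonoid.powers (U j))
      = fractionSet (Algebra.adjoin K (Set.range U)) (Submonoid.powers (U j)) :=
  (fractionSet_subset hx0 fun _ ha => H.exists_mul_pow_mem_of_mem_step hj hx0 ha).antisymm
    (fractionSet_subset hx0 fun _ ha => H.exists_mul_pow_mem_step hj hx0 ha)

variable {H}

namespace StageProperties

theorem bracket_step_of_lt (hU : H.StageProperties Q (j + 1) U) (hj : 0 < (j : ℕ)) {l : Fin n}
    (hl : l < j) : Q (U j) (H.step F j U l) = H.lam j l • (U j * H.step F j U l) := by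
  have hx : ∀ a, Q (U j) (evalBelow U j a)
      = evalBelow U j (H.α j a) * U j + evalBelow U j (H.D j 1 a) := fun a => by
    rw [H.D_one j hj]
    exact hU.bracket_evalBelow_of_lt (Nat.lt_succ_self j) a
  rw [H.step_of_lt U j hl, stepParam, bracket_x_deletingMap _ Q (H.η_ne_zero j hj) (hU.ne_zero j)
    (H.D_locallyNilpotent j hj) (H.D_iterative j hj) (H.D_skewPoisson j hj).comm hx, H.α_X,
    deletingMap_smul _ _ (H.D_locallyNilpotent j hj), smul_mul_assoc, mul_comm (U j)]

/-- By `α_D`, the value of `D_{j,k}(X_l)` has weight `λ_il + k λ_ij` under `{U i, -}`, and `(U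
j)^{-k}` has weight `-k λ_ij`. -/
theorem bracket_step_of_gt (hU : H.StageProperties Q (j + 1) U) (hj : 0 < (j : ℕ)) {i l : Fin n}
    (hl : l < j) (hi : j < i) :
    Q (U i) (H.step F j U l) = H.lam i l • (U i * H.step F j U l) := by
  rw [H.step_of_lt U j hl, mul_comm (U i)]
  refine bracket_deletingMap_of_weight _ _ Q (H.D_locallyNilpotent j hj) _ _ _ (H.lam i j)
    (fun k => ?_) ?_
  · have e : (⟨H.α i (inclBelow K hi (varBelow K hl)), diag_mem_polyBelow hi (H.α i) (H.lam i)
        (H.α_X i) _⟩ : polyBelow K j) = H.lam i l • varBelow K hl := by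
      have := congrArg (fun z : polyBelow K i => (z : MvPolynomial (Fin n) K))
        (H.α_X i l (hl.trans hi))
      exact Subtype.ext this
    rw [← evalBelow_inclBelow U hi, hU.bracket_evalBelow_of_ge (Fin.lt_def.mp hi), H.α_D i j hi hj, e,
      map_smul, ← add_smul, map_smul, map_smul, smul_mul_assoc]
  · rw [stepParam, bracket_inv Q _ (hU.ne_zero j), hU.bracket_above i j (Fin.lt_def.mp hi) hi]
    have := hU.ne_zero j
    simp only [Algebra.smul_def]
    field_simp

theorem bracket_evalBelow_step (hU : H.StageProperties Q (j + 1) U) (hj : 0 < (j : ℕ))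
    (a b : polyBelow K j) : Q (evalBelow (H.step F j U) j a) (evalBelow (H.step F j U) j b)
      = evalBelow (H.step F j U) j (H.bracket.restrict _ (H.closed j) a b) := by
  have hx : ∀ a, Q (U j) (evalBelow U j a)
      = evalBelow U j (H.α j a) * U j + evalBelow U j (H.D j 1 a) := fun a => by
    rw [H.D_one j hj]
    exact hU.bracket_evalBelow_of_lt (Nat.lt_succ_self j) a
  simp only [H.evalBelow_step U hj, stepParam]
  exact bracket_deletingMap _ _ Q (H.η_ne_zero j hj) (hU.ne_zero j) (H.D_locallyNilpotent j hj)
    (H.D_iterative j hj) (H.D_skewPoisson j hj)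
    (fun a b => hU.bracket_evalBelow_evalBelow (Nat.lt_succ_self j) a b) hx a b

/-- The index `j` leaves the lower range: `θ` keeps the brackets below `j` and makes those with `U
j` quadratic. -/
theorem step (hU : H.StageProperties Q (j + 1) U) (hj : 0 < (j : ℕ)) :
    H.StageProperties Q j (H.step F j U) := by
  have hdiv : ∀ f : F, ∃ c ∈ Algebra.adjoin K (Set.range (H.step F j U)),
      ∃ d ∈ Algebra.adjoin K (Set.range (H.step F j U)), f = c / d := fun f => by
    have hx0 := hU.ne_zero j
    have hx : U j ∈ Algebra.adjoin K (Set.range (H.step F j U)) := by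
      have := mem_adjoin_range (K := K) (H.step F j U) j
      rwa [step_self] at this
    obtain ⟨c, hc, d, hd, rfl⟩ := hU.exists_div f
    obtain ⟨k, hk⟩ := H.exists_mul_pow_mem_step hj hx0 hc
    obtain ⟨l, hl⟩ := H.exists_mul_pow_mem_step hj hx0 hd
    -- Numerator and denominator are both multiplied by `U j ^ (k + l)`.
    refine ⟨_, Subalgebra.mul_mem _ hk (Subalgebra.pow_mem _ hx l),
      _, Subalgebra.mul_mem _ hl (Subalgebra.pow_mem _ hx k), ?_⟩
    rw [mul_assoc, mul_assoc, mul_comm (U j ^ l), mul_div_mul_right _ _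
      (mul_ne_zero (pow_ne_zero _ hx0) (pow_ne_zero _ hx0))]
  refine ⟨algebraicIndependent_of_isFractionRing hU.indep (isFractionRing_subalgebra hdiv),
    fun a ha b hb => by
    simpa only [evalBelow_apply, restrict_apply]
      using hU.bracket_evalBelow_step hj ⟨a, ha⟩ ⟨b, hb⟩, fun i l hi hl => ?_, hdiv⟩
  rw [H.step_of_not_lt U j (not_lt.mpr hi)]
  rcases eq_or_lt_of_le (show j ≤ i from hi) with rfl | hji
  · exact hU.bracket_step_of_lt hj hl
  · by_cases hlj : l < j
    · exact hU.bracket_step_of_gt hj hlj hji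
    · rw [H.step_of_not_lt U j hlj]
      exact hU.bracket_above i l hji hl

end StageProperties

end Step

/-! ### Descending through the stages -/

section Stage

variable (H) (F) [Algebra (MvPolynomial (Fin n) K) F]

theorem stage_of_lt {j : Fin n} : H.stage F j = H.step F j (H.stage F (j + 1)) := by
  rw [stage, dif_pos j.2]

variable [IsScalarTower K (MvPolynomial (Fin n) K) F]
  [IsFractionRing (MvPolynomial (Fin n) K) F]

theorem stageProperties_of_ge {m : ℕ} (hm : n ≤ m) :
    H.StageProperties (H.bracket.frac F) m (H.stage F m) := by
  have hs : H.stage F m = fun i => algebraMap (MvPolynomial (Fin n) K) F (X i) := by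
    rw [stage, dif_neg (not_lt.mpr hm)]
  -- At the start the generators are the original variables, and `bracket_above` is vacuous since no
  -- index reaches `m ≥ n`.
  have hev : ∀ a, aeval (H.stage F m) a = algebraMap (MvPolynomial (Fin n) K) F a := fun a => by
    rw [hs]
    exact DFunLike.congr_fun
      (MvPolynomial.algHom_ext (f := aeval fun i => algebraMap (MvPolynomial (Fin n) K) F (X i))
        (g := IsScalarTower.toAlgHom K (MvPolynomial (Fin n) K) F) (fun i => by simp)) a
  refine ⟨?_, fun a _ b _ => ?_, fun i l hi => absurd i.2 (not_lt.mpr (hm.trans hi)), fun f => ?_⟩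
  · rw [algebraicIndependent_iff_injective_aeval]
    intro a b hab
    rw [hev, hev] at hab
    exact IsFractionRing.injective _ F hab
  · rw [hev, hev, hev, frac_algebraMap]
  · obtain ⟨a, s, _, rfl⟩ := IsFractionRing.div_surjective (A := MvPolynomial (Fin n) K) f
    rw [← hev a, ← hev s]
    exact ⟨_, aeval_mem_adjoin_range _ _, _, aeval_mem_adjoin_range _ _, rfl⟩

/-- Descending recursion from `n`; it stops at `1` because the hypotheses on `D` and `η` exclude the
index `0`. -/
theorem stageProperties {m : ℕ} (hm : 1 ≤ m) :
    H.StageProperties (H.bracket.frac F) m (H.stage F m) := by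
  rcases le_or_gt n m with h | h
  · exact H.stageProperties_of_ge F h
  · have := stageProperties (m := m + 1) (by omega)
    rw [H.stage_of_lt F (j := ⟨m, h⟩)]
    exact this.step (j := ⟨m, h⟩) hm
termination_by n - m

theorem isPoissonAffineSpace_stageAlg_one :
    (H.bracket.frac F).IsPoissonAffineSpace (H.stageAlg F 1) H.lam (H.stage F 1) := by
  have h := H.stageProperties F le_rfl
  have key : ∀ i l : Fin n, l < i → H.bracket.frac F (H.stage F 1 i) (H.stage F 1 l)
      = H.lam i l • (H.stage F 1 i * H.stage F 1 l) := fun i l hl =>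
    -- `l < i` forces `1 ≤ i`, so every such pair lies in the quadratic range.
    h.bracket_above i l (by have := Fin.lt_def.mp hl; omega) hl
  refine ⟨H.lam_skew, H.lam_self, h.indep, rfl, h.isPoissonSubalgebra, fun i l => ?_⟩
  rcases lt_trichotomy i l with hil | rfl | hil
  · rw [PoissonBracket.skew, key l i hil, H.lam_skew i l, neg_smul, mul_comm]
  · rw [PoissonBracket.self', H.lam_self, zero_smul]
  · exact key i l hil

end Stage

end DeletingClass

end

/-! ### The main theorem -/

theorem mainTheorem7 {K : Type*} [Field K] {n : ℕ} (H : DeletingClass K n)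
    (F : Type*) [Field F] [Algebra K F] [Algebra (MvPolynomial (Fin n) K) F]
    [IsScalarTower K (MvPolynomial (Fin n) K) F] [IsFractionRing (MvPolynomial (Fin n) K) F] :
    -- every step yields algebraically independent elements generating a Poisson subalgebra
    (∀ j : ℕ, 1 ≤ j → j ≤ n → AlgebraicIndependent K (H.stage F j) ∧
      (H.bracket.frac F).IsPoissonSubalgebra (H.stageAlg F j)) ∧
    -- consecutive steps have the same localization at the powers of `U_j = V_j`
    (∀ j : Fin n, 0 < (j : ℕ) →
      H.stage F j j = H.stage F (j + 1) j ∧ H.stage F (j + 1) j ≠ 0 ∧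
      fractionSet (H.stageAlg F j) (Submonoid.powers (H.stage F (j + 1) j)) =
        fractionSet (H.stageAlg F (j + 1)) (Submonoid.powers (H.stage F (j + 1) j))) ∧
    -- the last algebra is the Poisson affine space associated to `lam`
    (H.bracket.frac F).IsPoissonAffineSpace (H.stageAlg F 1) H.lam (H.stage F 1) ∧
    -- `Frac A` is also the fraction field of the last algebra, with the same Poisson bracket
    (∃ (h : (H.bracket.frac F).IsPoissonSubalgebra (H.stageAlg F 1))
      (_ : IsFractionRing (H.stageAlg F 1) F),
      ((H.bracket.frac F).restrict (H.stageAlg F 1) h).frac F = H.bracket.frac F) := by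
  have h1 := H.stageProperties F le_rfl
  have hfrac : IsFractionRing (H.stageAlg F 1) F := isFractionRing_subalgebra h1.exists_div
  refine ⟨fun j hj _ => ⟨(H.stageProperties F hj).indep,
      (H.stageProperties F hj).isPoissonSubalgebra⟩,
    fun j hj => ?_, H.isPoissonAffineSpace_stageAlg_one F, h1.isPoissonSubalgebra, hfrac, ?_⟩
  · have hx0 := (H.stageProperties F (Nat.le_add_left 1 j)).ne_zero j
    refine ⟨?_, hx0, ?_⟩
    · rw [H.stage_of_lt F, H.step_self]
    · rw [DeletingClass.stageAlg, H.stage_of_lt F]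
      exact H.fractionSet_step hj hx0
  -- The bracket of `F` extends its own restriction by definition, so uniqueness of the extension
  -- applies.
  · exact (PoissonBracket.frac_unique _ _ fun a b => rfl).symm
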